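/- **Setting.** Let $W^\star\in\mathbb R^{m\times d}$, $X\in\mathbb R^{d\times n}$, $Y=W^\star X$, with singular values $\sigma_1\ge\sigma_2\ge\cdots$ ($\sigma_j=0$ for $j>\min(m,n)$). Let $r\ge 1$ and assume $\sigma_1>\cdots>\sigma_r>0$, $\sigma_1=1$, and that the gaps $\mathcal T_k=\min\{\min_{j>k}|\sigma_k-\sigma_j|,\sigma_k\}$ are positive for $k\le r$. Ideal components $(a_k^\star,b_k^\star)$, $k=1,\dots,r$, are defined successively: with $Y_k^\star=Y-\sum_{k'<k}b_{k'}^\star a_{k'}^{\star\top}X$, the pair $(a_k^\star,b_k^\star)$ minimizes $\|Y_k^\star-ba^\top X\|_F$ over $a\in\mathbb R^d$, $b\in\mathbb R^m$. **Parallel deflation.** Worker $k\in\{1,\dots,r\}$ holds $(a_{k,\ell},b_{k,\ell})$ after round $\ell$; the initial factors satisfy $\|b_{k,0}a_{k,0}^\top X\|_F\le Q$, where $Q\ge 2\sigma_1$. In rounds $1\le \ell<k$ its factors do not change. In each round $\ell\ge k$ it applies a rank-1 subroutine to the target $Y_{k,\ell}=Y-\sum_{k'<k}b_{k',\ell-1}a_{k',\ell-1}^\top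 X$, warm-started at $(a_{k,\ell-1},b_{k,\ell-1})$, obtaining $(\tilde a_{k,\ell},\tilde b_{k,\ell})$, and takes new factors with $b_{k,\ell}a_{k,\ell}^\top X=\Pi_Q(\tilde b_{k,\ell}\tilde a_{k,\ell}^\top X)$, where $\Pi_Q$ is the projection onto the Frobenius ball of radius $Q$. Assume that for each $k\le r$ there is $\mathcal F_k\in(0,1)$ such that for all $\ell\ge k$ $$\|\tilde b_{k,\ell}\tilde a_{k,\ell}^\top X-\bar b_{k,\ell}\bar a_{k,\ell}^\top X\|_F\le\mathcal F_k\,\|b_{k,\ell-1}a_{k,\ell-1}^\top X-\bar b_{k,\ell}\bar a_{k,\ell}^\top X\|_F ,$$ where $(\bar a_{k,\ell},\bar b_{k,\ell})$ minimizes $\|Y_{k,\ell}-ba^\top X\|_F$. **Constants.** Put $\mathcal R_k=Q+\sigma_k$, $C_k=3\sigma_k/\mathcal T_k+1$, $m_1=\mathcal F_1$ and $m_k=\max\{\mathcal F_k,\frac1k+\frac{k-1}k m_{k-1}\}$ for $k\ge2$. Let $\hat W(a)=\max\{1,-W_{-1}(-a)\}$ for $0<a\le 1/e$, where $W_{-1}$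 is the lower real branch of the Lambert function. Let $s_1=1$ and let $s_2,\dots,s_r$ be natural numbers such that for $1\le k<r$ $$s_{k+1}\ge\max_{1\le k'\le k}\Bigl\{s_{k'}+\frac{\hat W\bigl(\frac{m_{k'}|\log m_{k'}|}{k}\bigr)}{\log(1/m_{k'})}+\frac{\hat W\bigl(\frac{\mathcal T_{k+1}m_{k'}|\log m_{k'}|}{6k\mathcal R_{k'}C_{k+1}}\bigr)}{\log(1/m_{k'})}\Bigr\}+\frac{(k+1)m_k}{1-m_k}+2+\frac{\hat W(m_k|\log m_k|)}{\log(1/m_k)} .$$ **Claim (self-correction).** For every $1\le k\le r$ and every $\ell\ge s_k$, $$\|Y_{k,\ell}-Y_k^\star\|_F\le 3\sum_{k'=1}^{k-1}\mathcal R_{k'}(\ell-s_{k'}+1)\,m_{k'}^{\ell-s_{k'}},$$ and the right-hand side, hence also the left-hand side, tends to $0$ as $\ell\to\infty$. In contrast, consider sequential deflation, in which step $k$ computes $(a_k,b_k)$ by an arbitrary rank-1 subroutine from $Y_k=Y-\sum_{k'<k}b_{k'}a_{k'}^\top X$ and never changes it afterwards. Then the mismatch $\|Y_k-Y_k^\star\|_F$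 does not change in any later step: for every $\ell\ge k$ the target of component $k$ formed from the estimates available at the start of step $\ell$ has the same mismatch. For $2\le k\le r$ this mismatch is generically nonzero: the predecessor outputs $(a_{k'},b_{k'})_{k'<k}\in(\mathbb R^d\times\mathbb R^m)^{k-1}$ for which it vanishes form a nowhere dense set of Lebesgue measure zero. -/

import Mathlib

open Filter Topology MeasureTheory

attribute [local instance] Matrix.frobeniusNormedAddCommGroup

namespace ParallelDeflation

/-- A pair of rank-1 factors `(a, b)` with `a ∈ ℝ^d`, `b ∈ ℝ^m`. -/
abbrev Factors (m d : ℕ) := (Fin d → ℝ) × (Fin m → ℝ)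

/-- The component `b aᵀ X` produced by the factors `p = (a, b)`. -/
def component {m d n : ℕ} (X : Matrix (Fin d) (Fin n) ℝ) (p : Factors m d) :
    Matrix (Fin m) (Fin n) ℝ :=
  Matrix.vecMulVec p.2 p.1 * X

/-- A rank-1 subroutine: called with a target, the features, a number of local iterations and a
starting pair of factors, it returns a pair of factors. -/
abbrev Rank1 (m d n : ℕ) :=
  Matrix (Fin m) (Fin n) ℝ → Matrix (Fin d) (Fin n) ℝ → ℕ → Factors m d → Factors m d

/-- `Π_Q`: the metric projection onto the closed Frobenius ball of radius `Q` about `0`. -/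
noncomputable def projBall {m n : ℕ} (Q : ℝ) (M : Matrix (Fin m) (Fin n) ℝ) :
    Matrix (Fin m) (Fin n) ℝ :=
  if ‖M‖ ≤ Q then M else (Q / ‖M‖) • M

/-- The deflation target `Y_{k,ℓ} = Y - ∑_{k' < k} b_{k',ℓ-1} a_{k',ℓ-1}ᵀ X` of component `k` at
round `ℓ ≥ 1`; `w k ℓ` are the factors of component `k` after round `ℓ`, and components are
numbered from `1`. -/
def deflationTarget {m d n : ℕ} (X : Matrix (Fin d) (Fin n) ℝ) (Y : Matrix (Fin m) (Fin n) ℝ)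
    (w : ℕ → ℕ → Factors m d) (k ℓ : ℕ) : Matrix (Fin m) (Fin n) ℝ :=
  Y - ∑ k' ∈ Finset.Ico 1 k, component X (w k' (ℓ - 1))

/-- The clean deflation target `Y_k⋆ = Y - ∑_{k' < k} b_{k'}⋆ a_{k'}⋆ᵀ X`. -/
def cleanTarget {m d n : ℕ} (X : Matrix (Fin d) (Fin n) ℝ) (Y : Matrix (Fin m) (Fin n) ℝ)
    (wstar : ℕ → Factors m d) (k : ℕ) : Matrix (Fin m) (Fin n) ℝ :=
  Y - ∑ k' ∈ Finset.Ico 1 k, component X (wstar k')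

/-- `p = (a, b)` minimizes `‖Z - b aᵀ X‖_F` over all `a ∈ ℝ^d`, `b ∈ ℝ^m`. -/
def IsBestRank1Fit {m d n : ℕ} (X : Matrix (Fin d) (Fin n) ℝ) (Z : Matrix (Fin m) (Fin n) ℝ)
    (p : Factors m d) : Prop :=
  ∀ q : Factors m d, ‖Z - component X p‖ ≤ ‖Z - component X q‖

/-- `wstar 1, …, wstar r` are ideal components: the `k`-th is a best rank-1 fit of the `k`-th clean
target. -/
def IsIdealComponents {m d n : ℕ} (X : Matrix (Fin d) (Fin n) ℝ) (Y : Matrix (Fin m) (Fin n) ℝ)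
    (r : ℕ) (wstar : ℕ → Factors m d) : Prop :=
  ∀ k, 1 ≤ k → k ≤ r → IsBestRank1Fit X (cleanTarget X Y wstar k) (wstar k)

/-- The output of the rank-1 subroutine of worker `k` at round `ℓ`, warm-started from the factors of
the previous round, before projection. -/
def subroutineOutput {m d n : ℕ} (X : Matrix (Fin d) (Fin n) ℝ) (Y : Matrix (Fin m) (Fin n) ℝ)
    (rank1 : ℕ → ℕ → Rank1 m d n) (T : ℕ) (w : ℕ → ℕ → Factors m d) (k ℓ : ℕ) : Factors m d :=
  rank1 k ℓ (deflationTarget X Y w k ℓ) X T (w k (ℓ - 1))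

/-- `w` is a run of parallel rank-1 deflation with `r` workers, `T` local iterations and projection
radius `Q`. Worker `k` is idle in the rounds `ℓ < k`. In a round `ℓ ≥ k` it applies the subroutine
to its current target, and its new factors represent the projection onto the ball of radius `Q` of
the component that the subroutine returned. The subroutine may differ between workers and rounds
(for instance through its random choices). -/
structure IsParallelRun {m d n : ℕ} (X : Matrix (Fin d) (Fin n) ℝ) (Y : Matrix (Fin m) (Fin n) ℝ)
    (r : ℕ) (Q : ℝ) (rank1 : ℕ → ℕ → Rank1 m d n) (T : ℕ) (w : ℕ → ℕ → Factors m d) : Prop where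
  idle : ∀ k ℓ, 1 ≤ k → k ≤ r → 1 ≤ ℓ → ℓ < k → w k ℓ = w k (ℓ - 1)
  active : ∀ k ℓ, 1 ≤ k → k ≤ r → k ≤ ℓ →
    component X (w k ℓ) = projBall Q (component X (subroutineOutput X Y rank1 T w k ℓ))

/-- The rank-1 subroutine contracts, with factor `F k ∈ (0, 1)` for component `k`, towards the ideal
rank-1 fit `wbar k ℓ` of the current target, in every round `ℓ ≥ k`. -/
def SubroutineContracts {m d n : ℕ} (X : Matrix (Fin d) (Fin n) ℝ) (Y : Matrix (Fin m) (Fin n) ℝ)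
    (r : ℕ) (rank1 : ℕ → ℕ → Rank1 m d n) (T : ℕ) (w wbar : ℕ → ℕ → Factors m d) (F : ℕ → ℝ) :
    Prop :=
  ∀ k, 1 ≤ k → k ≤ r → 0 < F k ∧ F k < 1 ∧
    ∀ ℓ, k ≤ ℓ → IsBestRank1Fit X (deflationTarget X Y w k ℓ) (wbar k ℓ) ∧
      ‖component X (subroutineOutput X Y rank1 T w k ℓ) - component X (wbar k ℓ)‖
        ≤ F k * ‖component X (w k (ℓ - 1)) - component X (wbar k ℓ)‖

/-- The `k`-th largest singular value of `Y`, `k ≥ 1`; it is `0` for `k > min(m, n)`. -/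
noncomputable def sigma {m n : ℕ} (Y : Matrix (Fin m) (Fin n) ℝ) (k : ℕ) : ℝ :=
  (Matrix.toEuclideanLin Y).singularValues (k - 1)

/-- The spectral gap `min (min_{j > k} |σ_k - σ_j|) σ_k`. -/
noncomputable def gap {m n : ℕ} (Y : Matrix (Fin m) (Fin n) ℝ) (k : ℕ) : ℝ :=
  min (⨅ j : {j : ℕ // k < j}, |sigma Y k - sigma Y j|) (sigma Y k)

/-- `σ_1 > ⋯ > σ_r > 0`, all gaps are positive, and `σ_1 = 1`. -/
structure SpectralGap {m n : ℕ} (Y : Matrix (Fin m) (Fin n) ℝ) (r : ℕ) : Prop where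
  strict : ∀ k, 1 ≤ k → k < r → sigma Y (k + 1) < sigma Y k
  pos : ∀ k, 1 ≤ k → k ≤ r → 0 < sigma Y k
  gap_pos : ∀ k, 1 ≤ k → k ≤ r → 0 < gap Y k
  normalized : sigma Y 1 = 1

/-- The magnitude bound `R_k = Q + σ_k`. -/
noncomputable def magnitude {m n : ℕ} (Y : Matrix (Fin m) (Fin n) ℝ) (Q : ℝ) (k : ℕ) : ℝ :=
  Q + sigma Y k

/-- `C_k = 3 σ_k / gap_k + 1`. -/
noncomputable def mismatchConst {m n : ℕ} (Y : Matrix (Fin m) (Fin n) ℝ) (k : ℕ) : ℝ :=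
  3 * sigma Y k / gap Y k + 1

/-- The effective rates: `m_1 = F_1` and `m_k = max {F_k, 1/k + ((k-1)/k) m_{k-1}}` for `k ≥ 2`
(the value at `0` is not used). -/
noncomputable def rate (F : ℕ → ℝ) : ℕ → ℝ
  | 0 => 0
  | 1 => F 1
  | (k + 2) => max (F (k + 2))
      (1 / ((k : ℝ) + 2) + ((k : ℝ) + 1) / ((k : ℝ) + 2) * rate F (k + 1))

/-- The real Lambert branch `W_{-1}`: for `-1/e ≤ x < 0`, the unique `w ≤ -1` with `w e^w = x`. -/
noncomputable def lambertWm1 (x : ℝ) : ℝ :=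
  sSup {w : ℝ | w ≤ -1 ∧ w * Real.exp w = x}

/-- `Ŵ(a) = max {1, -W_{-1}(-a)}`, used for `0 < a ≤ 1/e`. -/
noncomputable def wHat (a : ℝ) : ℝ :=
  max 1 (-lambertWm1 (-a))

/-- The lower bound that the predecessor `k' ≤ k` imposes on the starting round `s_{k+1}`. -/
noncomputable def warmupBound {m n : ℕ} (Y : Matrix (Fin m) (Fin n) ℝ) (Q : ℝ) (F : ℕ → ℝ)
    (s : ℕ → ℕ) (k k' : ℕ) : ℝ :=
  (s k' : ℝ)
    + wHat (rate F k' * |Real.log (rate F k')| / k) / Real.log (1 / rate F k')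
    + wHat (gap Y (k + 1) * (rate F k' * |Real.log (rate F k')|)
          / (6 * k * magnitude Y Q k' * mismatchConst Y (k + 1))) / Real.log (1 / rate F k')
    + (((k : ℝ) + 1) * rate F k / (1 - rate F k) + 2
      + wHat (rate F k * |Real.log (rate F k)|) / Real.log (1 / rate F k))

/-- `s` is an admissible choice of starting rounds: `s_1 = 1`, and `s_{k+1}` is at least the maximum
over `k' ≤ k` of the warm-up bounds. -/
structure IsWarmup {m n : ℕ} (Y : Matrix (Fin m) (Fin n) ℝ) (r : ℕ) (Q : ℝ) (F : ℕ → ℝ)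
    (s : ℕ → ℕ) : Prop where
  start : s 1 = 1
  step : ∀ k, 1 ≤ k → k < r → ∀ k', 1 ≤ k' → k' ≤ k → warmupBound Y Q F s k k' ≤ (s (k + 1) : ℝ)

/-- `3 ∑_{k' < k} R_{k'} (ℓ - s_{k'} + 1) m_{k'}^{ℓ - s_{k'}}`, for `ℓ ≥ s_k`. -/
noncomputable def selfCorrectionBound {m n : ℕ} (Y : Matrix (Fin m) (Fin n) ℝ) (Q : ℝ)
    (F : ℕ → ℝ) (s : ℕ → ℕ) (k ℓ : ℕ) : ℝ :=
  3 * ∑ k' ∈ Finset.Ico 1 k,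
    magnitude Y Q k' * ((ℓ : ℝ) - (s k' : ℝ) + 1) * rate F k' ^ (ℓ - s k')

/-- `w` is a run of (inexact) sequential deflation: step `k` computes component `k` from the target
deflated by the components computed before, with budget `T k`; no other step changes component
`k`. -/
structure IsSequentialRun {m d n : ℕ} (X : Matrix (Fin d) (Fin n) ℝ)
    (Y : Matrix (Fin m) (Fin n) ℝ) (r : ℕ) (rank1 : ℕ → Rank1 m d n) (T : ℕ → ℕ)
    (w : ℕ → ℕ → Factors m d) : Prop where
  compute : ∀ k, 1 ≤ k → k ≤ r → w k k = rank1 k (deflationTarget X Y w k k) X (T k) (w k (k - 1))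
  frozen : ∀ k ℓ, 1 ≤ k → k ≤ r → 1 ≤ ℓ → ℓ ≠ k → w k ℓ = w k (ℓ - 1)

/-- The sequential deflation target `Y_k = Y - ∑_{k' < k} b_{k'} a_{k'}ᵀ X` as a function of the
predecessors' factors `p`. -/
def sequentialTarget {m d n : ℕ} (X : Matrix (Fin d) (Fin n) ℝ) (Y : Matrix (Fin m) (Fin n) ℝ)
    (k : ℕ) (p : Finset.Ico 1 k → Factors m d) : Matrix (Fin m) (Fin n) ℝ :=
  Y - ∑ i, component X (p i)

end ParallelDeflation

open ParallelDeflation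

/-!
Write `B k ℓ` for the component of worker `k` after round `ℓ` and `P k` for the ideal component.

*Best fits are Lipschitz, with no smallness condition.* The components form a cone in the Euclidean
space of matrices. If `P₀` is a best fit of `M` and the linear functional `⟪M, ·⟫` falls off at rate
`g` away from the direction of `P₀` on the unit vectors of the cone, then comparing the two optimality
conditions shows that a best fit of any `N` lies within `(2 ‖P₀‖ / g + 1) ‖N - M‖` of `P₀`
(`norm_bestFit_sub_le`). In an orthonormal basis of right singular vectors the clean target `k` is
`Y` restricted to the span of the basis vectors from the `k`-th on; for it the decay rate is the
spectral gap (`inner_residual_le`). The case `N = M` says that the best fit is unique, which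
identifies the `k`-th ideal component as the `k`-th singular component and carries the description
of the clean target over to `k + 1` (`component_ideal`).

*Propagation of errors.* The claim for the targets follows from
`‖B k (ℓ - 1) - P k‖ ≤ R_k (ℓ - s_k + 1) m_k ^ (ℓ - s_k)` for `ℓ ≥ s_k`
(`IsParallelRun.norm_component_sub_ideal_le`), by strong induction on `k`. The warm-up condition
makes the sum of the predecessors' bounds at round `s_k + j` at most
`T_k / (4 C_k) * m_k ^ (j + 1)` (`sum_predecessor_le`): the Lambert function is what bounds
`n ↦ n q ^ n` at `n = s_k - s_i`, and Bernoulli's inequality absorbs the further growth of the linear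
factor into the passage from `m_{k-1}` to `m_k`. So the best fit of the current target stays within
distance `m_k ^ (j + 1) / 2 ≤ 1 / 2` of `P k`, hence inside the projection ball, one round contracts
the error by `F k ≤ m_k` up to a perturbation `m_k ^ (j + 1)`, and unrolling gives the bound.

*Sequential deflation.* Frozen components give a frozen mismatch. It vanishes only if an entry of
`∑ component X (p i)`, which is homogeneous of degree two in the factors, takes a prescribed nonzero
value `c`. Dilation by `t > 0` carries the level set of `c` into that of `t ^ 2 * c`, so if the former
had positive measure, uncountably many disjoint sets would (`volume_level_eq_zero`).
-/

namespace ParallelDeflation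

/-! ### Best fits in a cone of an inner product space -/

section InnerProduct

variable {H : Type*} [NormedAddCommGroup H] [InnerProductSpace ℝ H]

/-- Pulling a point outside the ball of radius `Q` radially back to the sphere does not increase its
distance to a point of the ball. -/
theorem norm_radial_sub_le {Q : ℝ} {A B : H} (hQ : 0 ≤ Q) (hA : Q < ‖A‖) (hB : ‖B‖ ≤ Q) :
    ‖(Q / ‖A‖) • A - B‖ ≤ ‖A - B‖ := by
  have hA0 : 0 < ‖A‖ := hQ.trans_lt hA
  refine le_of_sq_le_sq ?_ (norm_nonneg _)
  have hi : inner ℝ A B ≤ ‖A‖ * Q :=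
    (real_inner_le_norm A B).trans (mul_le_mul_of_nonneg_left hB hA0.le)
  rw [norm_sub_sq_real, norm_sub_sq_real, norm_smul, real_inner_smul_left, Real.norm_of_nonneg
    (div_nonneg hQ hA0.le), div_mul_cancel₀ _ hA0.ne']
  have ht : 0 ≤ 1 - Q / ‖A‖ := by rw [sub_nonneg, div_le_one hA0]; exact hA.le
  have h1 : (1 - Q / ‖A‖) * inner ℝ A B ≤ (1 - Q / ‖A‖) * (‖A‖ * Q) :=
    mul_le_mul_of_nonneg_left hi ht
  have h2 : (1 - Q / ‖A‖) * (‖A‖ * Q) = ‖A‖ * Q - Q ^ 2 := by field_simp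
  nlinarith [sq_nonneg (‖A‖ - Q)]

/-- First-order conditions for a best fit `P` of `N` in a cone `S`, obtained by comparing `P` with
the rescalings of `P` and of `q`. -/
theorem inner_bestFit_self {S : Set H} (hS : ∀ t : ℝ, 0 ≤ t → ∀ q ∈ S, t • q ∈ S) {N P : H}
    (hP : P ∈ S) (hbest : ∀ q ∈ S, ‖N - P‖ ≤ ‖N - q‖) {q : H} (hq : q ∈ S) :
    inner ℝ N P = ‖P‖ ^ 2 ∧ inner ℝ N q ≤ ‖P‖ * ‖q‖ := by
  have hsq : ∀ t : ℝ, 0 ≤ t → ∀ q ∈ S,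
      -2 * inner ℝ N P + ‖P‖ ^ 2 ≤ -2 * (t * inner ℝ N q) + t ^ 2 * ‖q‖ ^ 2 := by
    intro t ht q hq
    have h := pow_le_pow_left₀ (norm_nonneg _) (hbest _ (hS t ht q hq)) 2
    rw [norm_sub_sq_real, norm_sub_sq_real, norm_smul, real_inner_smul_right,
      Real.norm_of_nonneg ht] at h
    linarith
  have hself : inner ℝ N P = ‖P‖ ^ 2 := by
    have h0 := hsq 0 le_rfl P hP
    by_cases hP0 : ‖P‖ = 0
    · simp [norm_eq_zero.mp hP0]
    have hpos : 0 < ‖P‖ ^ 2 := by positivity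
    -- The optimal scaling of `P` itself must be `1`.
    have h1 := hsq (inner ℝ N P / ‖P‖ ^ 2) (by
      apply div_nonneg _ hpos.le; nlinarith) P hP
    have h2 : -2 * (inner ℝ N P / ‖P‖ ^ 2 * inner ℝ N P) + (inner ℝ N P / ‖P‖ ^ 2) ^ 2 * ‖P‖ ^ 2
        = - (inner ℝ N P) ^ 2 / ‖P‖ ^ 2 := by field_simp; ring
    rw [h2, le_div_iff₀ hpos] at h1
    nlinarith [sq_nonneg (inner ℝ N P - ‖P‖ ^ 2)]
  refine ⟨hself, ?_⟩
  by_cases hq0 : ‖q‖ = 0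
  · simp [norm_eq_zero.mp hq0]
  have hqpos : 0 < ‖q‖ := lt_of_le_of_ne (norm_nonneg _) (Ne.symm hq0)
  have h := hsq (‖P‖ / ‖q‖) (by positivity) q hq
  rw [hself] at h
  have h2 : (‖P‖ / ‖q‖) ^ 2 * ‖q‖ ^ 2 = ‖P‖ ^ 2 := by field_simp
  rw [h2] at h
  by_cases hP0 : ‖P‖ = 0
  -- Here `‖P‖ = 0`, and small multiples of `q` show that `⟪N, q⟫` is at most any positive number.
  · have hneg : ∀ t : ℝ, 0 < t → inner ℝ N q ≤ t := by
      intro t ht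
      have h := hsq (2 * t / ‖q‖ ^ 2) (by positivity) q hq
      rw [hself, hP0] at h
      have h3 : -2 * (2 * t / ‖q‖ ^ 2 * inner ℝ N q) + (2 * t / ‖q‖ ^ 2) ^ 2 * ‖q‖ ^ 2
        = 4 * t / ‖q‖ ^ 2 * (t - inner ℝ N q) := by field_simp; ring
      rw [h3] at h
      have h4 : 0 ≤ 4 * t / ‖q‖ ^ 2 * (t - inner ℝ N q) := by linarith
      have h5 : 0 < 4 * t / ‖q‖ ^ 2 := by positivity
      linarith [nonneg_of_mul_nonneg_right h4 h5]
    rw [hP0, zero_mul]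
    exact le_of_forall_pos_le_add fun t ht => by linarith [hneg t ht]
  have hPpos : 0 < ‖P‖ := lt_of_le_of_ne (norm_nonneg _) (Ne.symm hP0)
  have h3 : ‖P‖ / ‖q‖ * inner ℝ N q ≤ ‖P‖ ^ 2 := by linarith
  rw [div_mul_eq_mul_div, div_le_iff₀ hqpos] at h3
  nlinarith

/-- Stability of best fits in a cone. The hypothesis `hgrowth` says that on unit vectors `q` of the
cone `⟪M, q⟫` falls below its maximum `σ` at least at rate `g (1 - ⟪P₀, q⟫ / σ)`; together with `hM`
it makes `P₀` the only best fit of `M`. No bound on `‖N - M‖` is needed. -/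
theorem norm_bestFit_sub_le {S : Set H} (hS : ∀ t : ℝ, 0 ≤ t → ∀ q ∈ S, t • q ∈ S)
    {M N P₀ P : H} {σ g : ℝ} (hσ : 0 < σ) (hg : 0 < g) (hP₀ : P₀ ∈ S) (hnorm : ‖P₀‖ = σ)
    (hM : inner ℝ M P₀ = σ ^ 2)
    (hgrowth : ∀ q ∈ S, inner ℝ M q ≤ σ * ‖q‖ - g * (‖q‖ - inner ℝ P₀ q / σ))
    (hP : P ∈ S) (hbest : ∀ q ∈ S, ‖N - P‖ ≤ ‖N - q‖) :
    ‖P - P₀‖ ≤ (2 * σ / g + 1) * ‖N - M‖ := by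
  obtain ⟨hself, hle⟩ := inner_bestFit_self hS hP hbest hP₀
  rw [hnorm] at hle
  have hE : 0 ≤ ‖N - M‖ := norm_nonneg _
  have hcs : ∀ x : H, |inner ℝ N x - inner ℝ M x| ≤ ‖N - M‖ * ‖x‖ := fun x => by
    rw [← inner_sub_left]; exact abs_real_inner_le_norm _ _
  -- The values of the two problems differ by at most the perturbation.
  have hlow : σ - ‖N - M‖ ≤ ‖P‖ := by
    have h := (abs_le.mp (hcs P₀)).1
    rw [hM, hnorm] at h
    nlinarith
  by_cases hP0 : ‖P‖ = 0
  · rw [norm_eq_zero.mp hP0, zero_sub, norm_neg, hnorm]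
    have : 0 ≤ 2 * σ / g * ‖N - M‖ := by positivity
    linarith
  have hPpos : 0 < ‖P‖ := lt_of_le_of_ne (norm_nonneg _) (Ne.symm hP0)
  set τ := ‖P‖ with hτ
  set p := τ⁻¹ • P with hp
  set p₀ := σ⁻¹ • P₀ with hp₀
  have hpn : ‖p‖ = 1 := by
    rw [hp, norm_smul, norm_inv, Real.norm_of_nonneg hPpos.le, ← hτ, inv_mul_cancel₀ hP0]
  have hp₀n : ‖p₀‖ = 1 := by
    rw [hp₀, norm_smul, norm_inv, Real.norm_of_nonneg hσ.le, hnorm, inv_mul_cancel₀ hσ.ne']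
  have hNp : inner ℝ N p = τ := by
    rw [hp, real_inner_smul_right, hself]; field_simp
  have hMp₀ : inner ℝ M p₀ = σ := by
    rw [hp₀, real_inner_smul_right, hM]; field_simp
  have hNp₀ : inner ℝ N p₀ ≤ τ := by
    rw [hp₀, real_inner_smul_right, inv_mul_le_iff₀ hσ]; linarith
  have hPp : P = τ • p := by rw [hp, smul_smul, mul_inv_cancel₀ hP0, one_smul]
  have hPp₀ : P₀ = σ • p₀ := by rw [hp₀, smul_smul, mul_inv_cancel₀ hσ.ne', one_smul]
  have hMp := hgrowth p (hS _ (by positivity) P hP)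
  rw [hpn, hPp₀, real_inner_smul_left, mul_div_cancel_left₀ _ hσ.ne'] at hMp
  have hc1 : inner ℝ p₀ p ≤ 1 := by
    have := real_inner_le_norm p₀ p
    rwa [hpn, hp₀n, one_mul] at this
  have hD : ‖p - p₀‖ ^ 2 = 2 - 2 * inner ℝ p₀ p := by
    rw [norm_sub_sq_real, hpn, hp₀n, real_inner_comm]; ring
  have hup : τ ≤ σ + ‖N - M‖ := by
    have h := (abs_le.mp (hcs p)).2
    rw [hNp, hpn] at h
    nlinarith
  have hdir : ‖p - p₀‖ ≤ 2 / g * ‖N - M‖ := by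
    have h := (abs_le.mp (hcs (p - p₀))).2
    rw [inner_sub_right, inner_sub_right, hNp, hMp₀] at h
    have h2 : g * ‖p - p₀‖ ^ 2 ≤ 2 * ‖N - M‖ * ‖p - p₀‖ := by rw [hD]; nlinarith
    by_cases h0 : ‖p - p₀‖ = 0
    · rw [h0]; positivity
    have h0' : 0 < ‖p - p₀‖ := lt_of_le_of_ne (norm_nonneg _) (Ne.symm h0)
    rw [div_mul_eq_mul_div, le_div_iff₀ hg]
    nlinarith
  have hdecomp : P - P₀ = (τ - σ) • p + σ • (p - p₀) := by
    rw [smul_sub, sub_smul, ← hPp, ← hPp₀]; abel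
  calc ‖P - P₀‖ ≤ |τ - σ| * 1 + σ * ‖p - p₀‖ := by
        rw [hdecomp]
        refine (norm_add_le _ _).trans (le_of_eq ?_)
        rw [norm_smul _ p, norm_smul σ, hpn, Real.norm_eq_abs, Real.norm_of_nonneg hσ.le]
    _ ≤ ‖N - M‖ + σ * (2 / g * ‖N - M‖) := by
        have : |τ - σ| ≤ ‖N - M‖ := abs_le.mpr ⟨by linarith, by linarith⟩
        gcongr
        linarith
    _ = (2 * σ / g + 1) * ‖N - M‖ := by ring

end InnerProduct

/-! ### Singular vectors and deflated operators -/

section Spectral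

variable {E F : Type*} [NormedAddCommGroup E] [InnerProductSpace ℝ E]
  [NormedAddCommGroup F] [InnerProductSpace ℝ F]

/-- The operator `T` deflated by its first `k` singular components, with respect to the right
singular basis `e`: it annihilates `e 0, …, e (k - 1)` and agrees with `T` on the other `e i`. -/
noncomputable def residual {n : ℕ} (T : E →ₗ[ℝ] F) (e : OrthonormalBasis (Fin n) ℝ E) (k : ℕ)
    (x : E) : F :=
  ∑ i : Fin n, if (i : ℕ) < k then 0 else inner ℝ (e i) x • T (e i)

variable {n : ℕ} {T : E →ₗ[ℝ] F} {e : OrthonormalBasis (Fin n) ℝ E}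

theorem residual_zero (x : E) : residual T e 0 x = T x := by
  conv_rhs => rw [← e.sum_repr' x, map_sum]
  simp [residual]

theorem residual_eq_add (i : Fin n) (x : E) :
    residual T e i x = inner ℝ (e i) x • T (e i) + residual T e (i + 1) x := by
  have h : ∀ j : Fin n, (if (j : ℕ) < i then (0 : F) else inner ℝ (e j) x • T (e j))
      = (if j = i then inner ℝ (e j) x • T (e j) else 0)
        + (if (j : ℕ) < i + 1 then 0 else inner ℝ (e j) x • T (e j)) := by
    intro j
    rcases lt_trichotomy (j : ℕ) i with hj | hj | hj
    · have : j ≠ i := fun h => by simp [h] at hj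
      simp [hj, this, hj.trans (Nat.lt_succ_self _)]
    · have : j = i := Fin.ext hj
      simp [this]
    · have : j ≠ i := fun h => by simp [h] at hj
      have h2 : ¬ (j : ℕ) < i + 1 := by omega
      simp [this, h2, hj.not_gt]
  simp only [residual, h, Finset.sum_add_distrib]
  simp

variable [FiniteDimensional ℝ E] [FiniteDimensional ℝ F]

/-- There is an orthonormal basis of right singular vectors, in the order of Mathlib's singular
values. -/
theorem exists_rightSingularBasis (T : E →ₗ[ℝ] F) {n : ℕ} (hn : Module.finrank ℝ E = n) :
    ∃ e : OrthonormalBasis (Fin n) ℝ E,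
      ∀ i, LinearMap.adjoint T (T (e i)) = T.singularValues i ^ 2 • e i := by
  refine ⟨T.isSymmetric_adjoint_comp_self.eigenvectorBasis hn, fun i => ?_⟩
  have h := T.isSymmetric_adjoint_comp_self.apply_eigenvectorBasis hn i
  rw [T.sq_singularValues_fin hn i]
  exact h

variable (he : ∀ i, LinearMap.adjoint T (T (e i)) = T.singularValues i ^ 2 • e i)
include he

theorem inner_map_rightSingularBasis (i j : Fin n) :
    inner ℝ (T (e i)) (T (e j)) = if i = j then T.singularValues i ^ 2 else 0 := by
  rw [← LinearMap.adjoint_inner_left, he, real_inner_smul_left, e.inner_eq_ite]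
  simp

theorem norm_map_rightSingularBasis (i : Fin n) : ‖T (e i)‖ = T.singularValues i := by
  refine (sq_eq_sq₀ (norm_nonneg _) (T.singularValues_nonneg i)).mp ?_
  rw [← real_inner_self_eq_norm_sq, inner_map_rightSingularBasis he, if_pos rfl]

theorem inner_map_residual (i : Fin n) {k : ℕ} (hi : (i : ℕ) < k) (x : E) :
    inner ℝ (T (e i)) (residual T e k x) = 0 := by
  rw [residual, inner_sum]
  refine Finset.sum_eq_zero fun j _ => ?_
  split_ifs with hj
  · simp
  · have : i ≠ j := fun h => by subst h; exact hj hi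
    rw [real_inner_smul_right, inner_map_rightSingularBasis he, if_neg this, mul_zero]

theorem norm_residual_sq (k : ℕ) (x : E) : ‖residual T e k x‖ ^ 2
    = ∑ i : Fin n, if (i : ℕ) < k then 0 else T.singularValues i ^ 2 * inner ℝ (e i) x ^ 2 := by
  rw [← real_inner_self_eq_norm_sq]
  nth_rw 1 [residual]
  rw [sum_inner]
  refine Finset.sum_congr rfl fun i _ => ?_
  split_ifs with hi
  · simp
  rw [real_inner_smul_left, residual, inner_sum, Finset.sum_eq_single i]
  · rw [if_neg hi, real_inner_smul_right, inner_map_rightSingularBasis he, if_pos rfl]; ring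
  · intro j _ hj
    split_ifs
    · simp
    · rw [real_inner_smul_right, inner_map_rightSingularBasis he, if_neg hj.symm, mul_zero]
  · simp

theorem norm_residual_succ_sq_le (i : Fin n) (x : E) : ‖residual T e (i + 1) x‖ ^ 2
    ≤ T.singularValues (i + 1) ^ 2 * (‖x‖ ^ 2 - inner ℝ (e i) x ^ 2) := by
  have hpar : ‖x‖ ^ 2 = ∑ j, inner ℝ (e j) x ^ 2 := by
    rw [← e.sum_sq_norm_inner_right x]; simp
  have hsub : ‖x‖ ^ 2 - inner ℝ (e i) x ^ 2
      = ∑ j ∈ Finset.univ.erase i, inner ℝ (e j) x ^ 2 := by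
    rw [hpar, ← Finset.add_sum_erase _ _ (Finset.mem_univ i)]; ring
  rw [norm_residual_sq he, hsub, Finset.mul_sum, ← Finset.add_sum_erase _ _ (Finset.mem_univ i),
    if_pos (Nat.lt_succ_self _), zero_add]
  refine Finset.sum_le_sum fun j _ => ?_
  split_ifs with hj
  · positivity
  · have h1 := T.singularValues_antitone (not_lt.mp hj)
    have h2 := T.singularValues_nonneg j
    exact mul_le_mul_of_nonneg_right (pow_le_pow_left₀ h2 h1 2) (sq_nonneg _)

/-- The bilinear form of the deflated operator has the quadratic growth that
`norm_bestFit_sub_le` requires: after splitting off the parts along the `i`-th singular vectors,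
only the singular values from `i + 1` on act on the rest. -/
theorem inner_residual_le {i : Fin n} (hi : 0 < T.singularValues i) {g : ℝ}
    (hg : g ≤ T.singularValues i - T.singularValues (i + 1)) (b : F) (c : E) :
    inner ℝ b (residual T e i c) ≤ T.singularValues i * (‖b‖ * ‖c‖)
      - g * (‖b‖ * ‖c‖ - inner ℝ b (T (e i)) * inner ℝ (e i) c / T.singularValues i) := by
  set σ := T.singularValues i
  set σ' := T.singularValues (i + 1)
  have hσ' : 0 ≤ σ' := T.singularValues_nonneg _
  set γ := inner ℝ (e i) c
  set z := residual T e (i + 1) c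
  set u := σ⁻¹ • T (e i) with hu
  have hun : ‖u‖ = 1 := by
    rw [hu, norm_smul, norm_map_rightSingularBasis he, norm_inv, Real.norm_of_nonneg hi.le,
      inv_mul_cancel₀ hi.ne']
  set β := inner ℝ b u with hβ
  have hbT : inner ℝ b (T (e i)) = σ * β := by
    rw [hβ, hu, real_inner_smul_right, mul_inv_cancel_left₀ hi.ne']
  have huz : inner ℝ u z = 0 := by
    rw [hu, real_inner_smul_left, inner_map_residual he i (Nat.lt_succ_self _), mul_zero]
  -- Only the part of `b` orthogonal to the left singular vector `u` sees the residual.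
  have hbz : inner ℝ b z = inner ℝ (b - β • u) z := by
    rw [inner_sub_left, real_inner_smul_left, huz]; ring
  have hbu : ‖b - β • u‖ ^ 2 = ‖b‖ ^ 2 - β ^ 2 := by
    rw [norm_sub_sq_real, real_inner_smul_right, norm_smul, hun, ← hβ, Real.norm_eq_abs, mul_one,
      sq_abs]; ring
  have hz := norm_residual_succ_sq_le he i c
  have hB : β ^ 2 ≤ ‖b‖ ^ 2 := by nlinarith [sq_nonneg ‖b - β • u‖]
  have hC : |γ| ≤ ‖c‖ := by
    have h := abs_real_inner_le_norm (e i) c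
    rwa [e.norm_eq_one, one_mul] at h
  have hB' : |β| ≤ ‖b‖ := abs_le_of_sq_le_sq hB (norm_nonneg _)
  have hβγ : |β * γ| ≤ ‖b‖ * ‖c‖ := by rw [abs_mul]; gcongr
  have hmain : inner ℝ b z ≤ σ' * (‖b‖ * ‖c‖ - |β * γ|) := by
    rw [hbz]
    refine (real_inner_le_norm _ _).trans ?_
    refine le_of_sq_le_sq ?_ (mul_nonneg hσ' (sub_nonneg.mpr hβγ))
    rw [mul_pow, hbu, mul_pow]
    have h1 : (‖b‖ ^ 2 - β ^ 2) * ‖z‖ ^ 2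
        ≤ (‖b‖ ^ 2 - β ^ 2) * (σ' ^ 2 * (‖c‖ ^ 2 - γ ^ 2)) :=
      mul_le_mul_of_nonneg_left hz (by linarith)
    have h2 : (‖b‖ ^ 2 - β ^ 2) * (‖c‖ ^ 2 - γ ^ 2) ≤ (‖b‖ * ‖c‖ - |β * γ|) ^ 2 := by
      rw [abs_mul, ← sq_abs β, ← sq_abs γ]
      nlinarith [sq_nonneg (‖b‖ * |γ| - ‖c‖ * |β|)]
    nlinarith [mul_le_mul_of_nonneg_left h2 (sq_nonneg σ')]
  rw [residual_eq_add, inner_add_right, real_inner_smul_right, hbT,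
    show σ * β * γ / σ = β * γ by field_simp]
  have h3 := le_abs_self (β * γ)
  nlinarith [mul_le_mul_of_nonneg_right hg (sub_nonneg.mpr (h3.trans hβγ)),
    mul_le_mul_of_nonneg_left h3 hσ']

end Spectral

/-! ### Frobenius geometry and the ideal components -/

section Frobenius

variable {m n d : ℕ}

/-- A matrix as the Euclidean vector of its entries. This carries the Frobenius norm to the norm of
an inner product space. -/
def entries : Matrix (Fin m) (Fin n) ℝ →ₗ[ℝ] EuclideanSpace ℝ (Fin m × Fin n) where
  toFun A := WithLp.toLp 2 fun p => A p.1 p.2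
  map_add' _ _ := rfl
  map_smul' _ _ := rfl

@[simp]
theorem entries_apply (A : Matrix (Fin m) (Fin n) ℝ) (i : Fin m) (j : Fin n) :
    entries A (i, j) = A i j := rfl

theorem inner_entries (A B : Matrix (Fin m) (Fin n) ℝ) :
    inner ℝ (entries A) (entries B) = ∑ i, ∑ j, A i j * B i j := by
  simp [PiLp.inner_apply, Fintype.sum_prod_type, mul_comm]

theorem norm_entries (A : Matrix (Fin m) (Fin n) ℝ) : ‖entries A‖ = ‖A‖ := by
  rw [Matrix.frobenius_norm_def, EuclideanSpace.norm_eq, Real.sqrt_eq_rpow,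
    Fintype.sum_prod_type]
  simp

theorem inner_entries_vecMulVec (A : Matrix (Fin m) (Fin n) ℝ) (b : EuclideanSpace ℝ (Fin m))
    (c : EuclideanSpace ℝ (Fin n)) :
    inner ℝ (entries A) (entries (Matrix.vecMulVec b.ofLp c.ofLp))
      = inner ℝ b (Matrix.toEuclideanLin A c) := by
  rw [inner_entries]
  simp [PiLp.inner_apply, Matrix.vecMulVec_apply, Matrix.mulVec, dotProduct,
    Finset.sum_mul]
  refine Finset.sum_congr rfl fun i _ => Finset.sum_congr rfl fun j _ => by ring

theorem toEuclideanLin_vecMulVec (b : EuclideanSpace ℝ (Fin m)) (c x : EuclideanSpace ℝ (Fin n)) :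
    Matrix.toEuclideanLin (Matrix.vecMulVec b.ofLp c.ofLp) x = inner ℝ c x • b := by
  ext i
  simp [PiLp.inner_apply, Matrix.vecMulVec_apply, Matrix.mulVec, dotProduct,
    Finset.sum_mul]
  refine Finset.sum_congr rfl fun j _ => by ring

theorem norm_entries_vecMulVec (b : EuclideanSpace ℝ (Fin m)) (c : EuclideanSpace ℝ (Fin n)) :
    ‖entries (Matrix.vecMulVec b.ofLp c.ofLp)‖ = ‖b‖ * ‖c‖ := by
  refine (sq_eq_sq₀ (norm_nonneg _) (by positivity)).mp ?_
  rw [← real_inner_self_eq_norm_sq, inner_entries_vecMulVec, toEuclideanLin_vecMulVec,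
    real_inner_smul_right, real_inner_self_eq_norm_sq, real_inner_self_eq_norm_sq]
  ring

theorem exists_component_eq_vecMulVec (X : Matrix (Fin d) (Fin n) ℝ) (p : Factors m d) :
    ∃ (b : EuclideanSpace ℝ (Fin m)) (c : EuclideanSpace ℝ (Fin n)),
      component X p = Matrix.vecMulVec b.ofLp c.ofLp :=
  ⟨WithLp.toLp 2 p.2, WithLp.toLp 2 (Matrix.vecMul p.1 X), by
    rw [component, Matrix.vecMulVec_mul]⟩

theorem smul_component (X : Matrix (Fin d) (Fin n) ℝ) (t : ℝ) (p : Factors m d) :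
    t • component X p = component X (p.1, t • p.2) := by
  rw [component, component, Matrix.smul_vecMulVec, Matrix.smul_mul]

end Frobenius

section SingularComponents

variable {m d n : ℕ} {X : Matrix (Fin d) (Fin n) ℝ} {Y : Matrix (Fin m) (Fin n) ℝ}
  {e : OrthonormalBasis (Fin n) ℝ (EuclideanSpace ℝ (Fin n))}

/-- The `i`-th singular component `(Y eᵢ) eᵢᵀ` of `Y`, counted from `0`. -/
noncomputable def singularComponent (Y : Matrix (Fin m) (Fin n) ℝ)
    (e : OrthonormalBasis (Fin n) ℝ (EuclideanSpace ℝ (Fin n))) (i : Fin n) :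
    Matrix (Fin m) (Fin n) ℝ :=
  Matrix.vecMulVec (Matrix.toEuclideanLin Y (e i)).ofLp (e i).ofLp

/-- The features constrain the right factor of a component to the row space of `X`. A right singular
vector of `Y = W⋆ X` with nonzero singular value lies there, since it is a multiple of `Yᵀ Y eᵢ`. -/
theorem exists_component_eq_singularComponent {Wstar : Matrix (Fin m) (Fin d) ℝ}
    (hY : Y = Wstar * X)
    (he : ∀ i, LinearMap.adjoint (Matrix.toEuclideanLin Y) (Matrix.toEuclideanLin Y (e i))
      = (Matrix.toEuclideanLin Y).singularValues i ^ 2 • e i)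
    {i : Fin n} (hi : 0 < (Matrix.toEuclideanLin Y).singularValues i) :
    ∃ p : Factors m d, component X p = singularComponent Y e i := by
  set σ := (Matrix.toEuclideanLin Y).singularValues i
  set y := Matrix.toEuclideanLin Y (e i)
  refine ⟨((σ ^ 2)⁻¹ • Matrix.vecMul y.ofLp Wstar, y.ofLp), ?_⟩
  have h := he i
  rw [← Matrix.toEuclideanLin_conjTranspose_eq_adjoint] at h
  have h2 : Matrix.vecMul y.ofLp Y = σ ^ 2 • (e i).ofLp := by
    rw [Matrix.conjTranspose_eq_transpose_of_trivial] at h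
    rw [← Matrix.mulVec_transpose]
    exact congrArg WithLp.ofLp h
  rw [component, singularComponent, Matrix.vecMulVec_mul, Matrix.smul_vecMul,
    Matrix.vecMul_vecMul, ← hY, h2, smul_smul, inv_mul_cancel₀ (by positivity), one_smul]

/-- If `M` acts as the residual `Y` deflated by its first `i` singular components, then the best
rank-1 fit of any `N` is close to the `i`-th singular component of `Y`. -/
theorem norm_component_sub_singularComponent_le {Wstar : Matrix (Fin m) (Fin d) ℝ}
    (hY : Y = Wstar * X)
    (he : ∀ i, LinearMap.adjoint (Matrix.toEuclideanLin Y) (Matrix.toEuclideanLin Y (e i))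
      = (Matrix.toEuclideanLin Y).singularValues i ^ 2 • e i)
    {i : Fin n} (hi : 0 < (Matrix.toEuclideanLin Y).singularValues i) {g : ℝ} (hg : 0 < g)
    (hg' : g ≤ (Matrix.toEuclideanLin Y).singularValues i
      - (Matrix.toEuclideanLin Y).singularValues (i + 1))
    {M N : Matrix (Fin m) (Fin n) ℝ}
    (hM : ∀ x, Matrix.toEuclideanLin M x = residual (Matrix.toEuclideanLin Y) e i x)
    {p : Factors m d} (hp : IsBestRank1Fit X N p) :
    ‖component X p - singularComponent Y e i‖
      ≤ (2 * (Matrix.toEuclideanLin Y).singularValues i / g + 1) * ‖N - M‖ := by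
  obtain ⟨p₀, hp₀⟩ := exists_component_eq_singularComponent hY he hi
  have hnorm : ‖entries (singularComponent Y e i)‖
      = (Matrix.toEuclideanLin Y).singularValues i := by
    rw [singularComponent, norm_entries_vecMulVec, e.norm_eq_one, mul_one,
      norm_map_rightSingularBasis he]
  have hb := norm_bestFit_sub_le (S := Set.range fun q : Factors m d => entries (component X q))
    (M := entries M) (N := entries N) (P₀ := entries (singularComponent Y e i))
    (P := entries (component X p)) ?_ hi hg ⟨p₀, by simp only [hp₀]⟩ hnorm ?_ ?_ ⟨p, rfl⟩ ?_
  · rwa [← map_sub, ← map_sub, norm_entries, norm_entries] at hb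
  · rintro t - _ ⟨q, rfl⟩
    exact ⟨(q.1, t • q.2), by simp only [← map_smul, smul_component]⟩
  · rw [singularComponent, inner_entries_vecMulVec, hM, residual_eq_add, inner_add_right,
      inner_map_residual he i (Nat.lt_succ_self _), real_inner_smul_right,
      real_inner_self_eq_norm_sq, real_inner_self_eq_norm_sq, e.norm_eq_one,
      norm_map_rightSingularBasis he]
    ring
  · rintro _ ⟨q, rfl⟩
    obtain ⟨b, c, hq⟩ := exists_component_eq_vecMulVec X q
    have h := inner_residual_le he hi hg' b c
    dsimp only
    rw [hq, inner_entries_vecMulVec, norm_entries_vecMulVec, hM, inner_entries_vecMulVec,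
      singularComponent, toEuclideanLin_vecMulVec, real_inner_smul_right]
    rwa [mul_comm (inner ℝ (e i) _)]
  · rintro _ ⟨q, rfl⟩
    simp only [← map_sub, norm_entries]
    exact hp q

end SingularComponents

section Ideal

variable {m d n : ℕ} {Y : Matrix (Fin m) (Fin n) ℝ} {r : ℕ}

theorem gap_le_sub (k : ℕ) (hk : 1 ≤ k) : gap Y k ≤ sigma Y k - sigma Y (k + 1) := by
  have h : sigma Y (k + 1) ≤ sigma Y k :=
    (Matrix.toEuclideanLin Y).singularValues_antitone (by omega)
  rw [← abs_of_nonneg (sub_nonneg.mpr h)]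
  refine (min_le_left _ _).trans ?_
  exact ciInf_le (f := fun j : {j : ℕ // k < j} => |sigma Y k - sigma Y j|)
    ⟨0, by rintro _ ⟨j, rfl⟩; exact abs_nonneg _⟩ ⟨k + 1, Nat.lt_succ_self k⟩

variable {X : Matrix (Fin d) (Fin n) ℝ} {e : OrthonormalBasis (Fin n) ℝ (EuclideanSpace ℝ (Fin n))}
  {wstar : ℕ → Factors m d}

theorem SpectralGap.lt_dim (hgap : SpectralGap Y r) {k : ℕ} (hk : 1 ≤ k) (hkr : k ≤ r) :
    k - 1 < n := by
  by_contra h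
  have h1 := hgap.pos k hk hkr
  rw [sigma, LinearMap.singularValues_of_finrank_le _ (by simpa using h)] at h1
  exact lt_irrefl _ h1

theorem cleanTarget_succ (k : ℕ) (hk : 1 ≤ k) :
    cleanTarget X Y wstar (k + 1) = cleanTarget X Y wstar k - component X (wstar k) := by
  rw [cleanTarget, cleanTarget, Finset.sum_Ico_succ_top hk, sub_sub]

/-- The ideal components are the singular components, and the clean targets are the residuals.
With components numbered from `1`, component `k` belongs to the basis vector `e (k - 1)`. -/
theorem component_ideal {Wstar : Matrix (Fin m) (Fin d) ℝ} (hY : Y = Wstar * X)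
    (hgap : SpectralGap Y r) (hstar : IsIdealComponents X Y r wstar)
    (he : ∀ i, LinearMap.adjoint (Matrix.toEuclideanLin Y) (Matrix.toEuclideanLin Y (e i))
      = (Matrix.toEuclideanLin Y).singularValues i ^ 2 • e i)
    {k : ℕ} (hk : 1 ≤ k) (hkr : k ≤ r) :
    (∀ x, Matrix.toEuclideanLin (cleanTarget X Y wstar k) x
        = residual (Matrix.toEuclideanLin Y) e (k - 1) x) ∧
      component X (wstar k) = singularComponent Y e ⟨k - 1, hgap.lt_dim hk hkr⟩ := by
  have hstep : ∀ k (hk : 1 ≤ k) (hkr : k ≤ r),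
      (∀ x, Matrix.toEuclideanLin (cleanTarget X Y wstar k) x
        = residual (Matrix.toEuclideanLin Y) e (k - 1) x) →
      component X (wstar k) = singularComponent Y e ⟨k - 1, hgap.lt_dim hk hkr⟩ := by
    intro k hk hkr hres
    have hg := gap_le_sub (Y := Y) k hk
    have h := norm_component_sub_singularComponent_le (i := ⟨k - 1, hgap.lt_dim hk hkr⟩) hY he
      (hgap.pos k hk hkr) (hgap.gap_pos k hk hkr)
      (by rw [sigma, sigma, Nat.add_sub_cancel] at hg; simpa [Nat.sub_add_cancel hk] using hg)
      hres (hstar k hk hkr)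
    rw [sub_self, norm_zero, mul_zero] at h
    exact sub_eq_zero.mp (norm_le_zero_iff.mp h)
  suffices hres : ∀ x, Matrix.toEuclideanLin (cleanTarget X Y wstar k) x
      = residual (Matrix.toEuclideanLin Y) e (k - 1) x from ⟨hres, hstep k hk hkr hres⟩
  induction k, hk using Nat.le_induction with
  | base => intro x; simp [cleanTarget, residual_zero]
  | succ k hk ih =>
    intro x
    have hk' : k ≤ r := by omega
    have hadd := residual_eq_add (T := Matrix.toEuclideanLin Y) (e := e)
      ⟨k - 1, hgap.lt_dim hk hk'⟩ x
    simp only [Nat.sub_add_cancel hk] at hadd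
    rw [cleanTarget_succ k hk, map_sub, LinearMap.sub_apply, ih hk', hstep k hk hk' (ih hk'),
      singularComponent, toEuclideanLin_vecMulVec, hadd, Nat.add_sub_cancel, add_sub_cancel_left]

theorem norm_component_ideal {Wstar : Matrix (Fin m) (Fin d) ℝ} (hY : Y = Wstar * X)
    (hgap : SpectralGap Y r) (hstar : IsIdealComponents X Y r wstar) {k : ℕ} (hk : 1 ≤ k)
    (hkr : k ≤ r) : ‖component X (wstar k)‖ = sigma Y k := by
  obtain ⟨e, he⟩ := exists_rightSingularBasis (Matrix.toEuclideanLin Y) finrank_euclideanSpace_fin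
  rw [(component_ideal hY hgap hstar he hk hkr).2, ← norm_entries, singularComponent,
    norm_entries_vecMulVec, e.norm_eq_one, mul_one, norm_map_rightSingularBasis he]
  rfl

theorem norm_bestFit_sub_ideal_le {Wstar : Matrix (Fin m) (Fin d) ℝ} (hY : Y = Wstar * X)
    (hgap : SpectralGap Y r) (hstar : IsIdealComponents X Y r wstar) {k : ℕ} (hk : 1 ≤ k)
    (hkr : k ≤ r) {N : Matrix (Fin m) (Fin n) ℝ} {p : Factors m d} (hp : IsBestRank1Fit X N p) :
    ‖component X p - component X (wstar k)‖
      ≤ mismatchConst Y k * ‖N - cleanTarget X Y wstar k‖ := by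
  obtain ⟨e, he⟩ := exists_rightSingularBasis (Matrix.toEuclideanLin Y) finrank_euclideanSpace_fin
  obtain ⟨hres, hcomp⟩ := component_ideal hY hgap hstar he hk hkr
  have hg := gap_le_sub (Y := Y) k hk
  have hpos := hgap.pos k hk hkr
  have hgpos := hgap.gap_pos k hk hkr
  have h := norm_component_sub_singularComponent_le (i := ⟨k - 1, hgap.lt_dim hk hkr⟩) hY he
      hpos hgpos
      (by rw [sigma, sigma, Nat.add_sub_cancel] at hg; simpa [Nat.sub_add_cancel hk] using hg)
      hres hp
  rw [hcomp]
  refine h.trans (mul_le_mul_of_nonneg_right ?_ (norm_nonneg _))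
  change 2 * sigma Y k / gap Y k + 1 ≤ 3 * sigma Y k / gap Y k + 1
  gcongr
  norm_num

theorem cleanTarget_ne {Wstar : Matrix (Fin m) (Fin d) ℝ} (hY : Y = Wstar * X)
    (hgap : SpectralGap Y r) (hstar : IsIdealComponents X Y r wstar) {k : ℕ} (hk : 2 ≤ k)
    (hkr : k ≤ r) : cleanTarget X Y wstar k ≠ Y := by
  obtain ⟨e, he⟩ := exists_rightSingularBasis (Matrix.toEuclideanLin Y) finrank_euclideanSpace_fin
  intro h
  have h1 : 1 ≤ r := by omega
  let i : Fin n := ⟨0, hgap.lt_dim le_rfl h1⟩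
  have hres := (component_ideal hY hgap hstar he (by omega) hkr).1 (e i)
  -- The leading right singular vector is annihilated by the clean target, but not by `Y`.
  have hzero : inner ℝ (Matrix.toEuclideanLin Y (e i)) (Matrix.toEuclideanLin Y (e i)) = 0 := by
    nth_rw 2 [← h]
    rw [hres]
    exact inner_map_residual he i (show 0 < k - 1 by omega) _
  rw [real_inner_self_eq_norm_sq, norm_map_rightSingularBasis he] at hzero
  exact (hgap.pos 1 le_rfl h1).ne' (pow_eq_zero_iff two_ne_zero |>.mp hzero)

end Ideal

/-! ### The Lambert function and exponential decay -/

/-- On `(0, 1/e]` the supremum that defines `lambertWm1` is attained, so `wHat a` is a solution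
`t ≥ 1` of `t e⁻ᵗ = a`. -/
theorem wHat_spec {a : ℝ} (ha : 0 < a) (ha' : a ≤ Real.exp (-1)) :
    1 ≤ wHat a ∧ wHat a * Real.exp (-wHat a) = a := by
  set S : Set ℝ := {w : ℝ | w ≤ -1 ∧ w * Real.exp w = -a} with hS
  have hcont : Continuous fun w : ℝ => w * Real.exp w := by fun_prop
  have hclosed : IsClosed S :=
    (isClosed_le continuous_id continuous_const).inter (isClosed_eq hcont continuous_const)
  have hbdd : BddAbove S := ⟨-1, fun w hw => hw.1⟩
  have hne : S.Nonempty := by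
    have hlim : Tendsto (fun x : ℝ => x ^ 1 * Real.exp (-x)) atTop (𝓝 0) :=
      Real.tendsto_pow_mul_exp_neg_atTop_nhds_zero 1
    obtain ⟨x, hx1, hx⟩ := ((eventually_ge_atTop 1).and (hlim.eventually (gt_mem_nhds ha))).exists
    have hx' : x * Real.exp (-x) < a := by simpa using hx
    have hIVT := intermediate_value_Icc' (show -x ≤ -1 by linarith) hcont.continuousOn
    obtain ⟨w, hw, hwa⟩ := hIVT (show -a ∈ _ from ⟨by linarith, by linarith⟩)
    exact ⟨w, hw.2, hwa⟩
  have hmem : lambertWm1 (-a) ∈ S := hclosed.csSup_mem hne hbdd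
  have h1 : 1 ≤ -lambertWm1 (-a) := by linarith [hmem.1]
  rw [wHat, max_eq_right h1]
  refine ⟨h1, ?_⟩
  rw [neg_neg]
  linarith [hmem.2]

/-- With `L = log (1 / q)` one has `n qⁿ = (x e⁻ˣ) / L` at `x = n L`, so the Lambert function tells
from where on `n qⁿ ≤ c q`. -/
theorem natCast_mul_pow_le {c q : ℝ} (hc : 0 < c) (hc1 : c ≤ 1) (hq : 0 < q) (hq1 : q < 1) {n : ℕ}
    (hn : wHat (c * (q * |Real.log q|)) / Real.log (1 / q) ≤ n) : n * q ^ n ≤ c * q := by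
  have hlog : Real.log q < 0 := Real.log_neg hq hq1
  set L := Real.log (1 / q) with hL
  have hLq : L = -Real.log q := by rw [hL, one_div, Real.log_inv]
  have hL0 : 0 < L := by rw [hLq]; linarith
  have hqL : q = Real.exp (-L) := by rw [hLq, neg_neg, Real.exp_log hq]
  rw [abs_of_neg hlog, ← hLq] at hn
  -- `L e⁻ᴸ ≤ 1/e`, so the argument of `wHat` lies in its domain.
  have hqLle : q * L ≤ Real.exp (-1) := by
    have h := Real.add_one_le_exp (L - 1)
    have h2 : Real.exp (-1) = Real.exp (L - 1) * q := by rw [hqL, ← Real.exp_add]; ring_nf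
    rw [h2]; nlinarith
  have hqL0 : 0 < q * L := by positivity
  obtain ⟨ht1, hta⟩ := wHat_spec (a := c * (q * L)) (by positivity) (by nlinarith)
  set t := wHat (c * (q * L))
  rw [div_le_iff₀ hL0] at hn
  set x := (n : ℝ) * L with hx
  -- `x ↦ x e⁻ˣ` decreases on `[1, ∞)`.
  have hdec : x * Real.exp (-x) ≤ t * Real.exp (-t) := by
    have h := Real.add_one_le_exp (x - t)
    have h2 : Real.exp (-t) = Real.exp (x - t) * Real.exp (-x) := by
      rw [← Real.exp_add]; ring_nf
    have h3 : x ≤ t * Real.exp (x - t) := by nlinarith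
    rw [h2, ← mul_assoc]
    exact mul_le_mul_of_nonneg_right h3 (Real.exp_pos _).le
  have hpow : q ^ n = Real.exp (-x) := by
    rw [hqL, ← Real.exp_nat_mul, hx]; ring_nf
  rw [hta] at hdec
  rw [hpow]
  have : L * (n * Real.exp (-x)) ≤ L * (c * q) := by rw [hx] at *; linarith
  exact le_of_mul_le_mul_left this hL0

/-! ### Effective rates -/

section Rates

variable {F : ℕ → ℝ} {r : ℕ}

theorem le_rate {k : ℕ} (hk : 1 ≤ k) : F k ≤ rate F k := by
  match k, hk with
  | 1, _ => exact le_rfl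
  | k + 2, _ => exact le_max_left _ _

theorem rate_add_le_rate_succ {k : ℕ} (hk : 1 ≤ k) :
    rate F k + (1 - rate F k) / (k + 1) ≤ rate F (k + 1) := by
  obtain ⟨k, rfl⟩ := Nat.exists_eq_add_of_le' hk
  refine le_trans (le_of_eq ?_) (le_max_right _ _)
  push_cast
  field_simp
  ring

theorem rate_pos_lt_one (hF : ∀ k, 1 ≤ k → k ≤ r → 0 < F k ∧ F k < 1) {k : ℕ} (hk : 1 ≤ k)
    (hkr : k ≤ r) : 0 < rate F k ∧ rate F k < 1 := by
  refine ⟨(hF k hk hkr).1.trans_le (le_rate hk), ?_⟩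
  induction k, hk using Nat.le_induction with
  | base => exact (hF 1 le_rfl hkr).2
  | succ k hk ih =>
    obtain ⟨k, rfl⟩ := Nat.exists_eq_add_of_le' hk
    refine max_lt (hF _ (by omega) hkr).2 ?_
    have h := ih (by omega)
    have hk0 : (0 : ℝ) < k + 2 := by positivity
    rw [div_mul_eq_mul_div, ← add_div, div_lt_one hk0]
    nlinarith [show (0 : ℝ) < k + 1 by positivity]

theorem rate_mono (hF : ∀ k, 1 ≤ k → k ≤ r → 0 < F k ∧ F k < 1) {i k : ℕ} (hi : 1 ≤ i)
    (hik : i ≤ k) (hkr : k ≤ r) : rate F i ≤ rate F k := by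
  induction k, hik using Nat.le_induction with
  | base => exact le_rfl
  | succ k hik ih =>
    have h := (rate_pos_lt_one hF (hi.trans hik) (by omega)).2
    refine (ih (by omega)).trans (le_trans ?_ (rate_add_le_rate_succ (hi.trans hik)))
    have : 0 ≤ (1 - rate F k) / (k + 1) := div_nonneg (by linarith) (by positivity)
    linarith

/-- By Bernoulli's inequality the increase of the rate from `μ` to `ν` absorbs a linear factor whose
relative growth per round is at most `1 / (n + 1)`. -/
theorem one_add_div_mul_pow_le {μ ν : ℝ} (hμ : 0 < μ) (hμ1 : μ < 1) {k n : ℕ}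
    (hν : μ + (1 - μ) / (k + 1) ≤ ν) (hn : (k + 1) * μ / (1 - μ) ≤ n) (j : ℕ) :
    (1 + j / (n + 1)) * μ ^ j ≤ ν ^ j := by
  set x : ℝ := (1 - μ) / ((k + 1) * μ) with hx
  have h1 : 0 < 1 - μ := by linarith
  have hx0 : 0 < x := by positivity
  have hnx : 1 / ((n : ℝ) + 1) ≤ x := by
    rw [div_le_iff₀ h1] at hn
    rw [hx, div_le_div_iff₀ (by positivity) (by positivity)]
    nlinarith
  have hbern := one_add_mul_le_pow (show (-2 : ℝ) ≤ x by linarith) j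
  calc (1 + j / (n + 1)) * μ ^ j ≤ (1 + x) ^ j * μ ^ j := by
        refine mul_le_mul_of_nonneg_right (le_trans ?_ hbern) (by positivity)
        rw [div_eq_mul_one_div]
        gcongr
    _ = (μ + (1 - μ) / (k + 1)) ^ j := by
        rw [← mul_pow, hx]; congr 1; field_simp
    _ ≤ ν ^ j := pow_le_pow_left₀ (by positivity) hν j

theorem succ_mul_pow_le {q μ ν c : ℝ} (hq : 0 < q) (hqμ : q ≤ μ) (hμ1 : μ < 1) {k n : ℕ}
    (hν : μ + (1 - μ) / (k + 1) ≤ ν) (hn2 : 2 ≤ n) (hn : (k + 1) * μ / (1 - μ) ≤ n)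
    (hc : n * q ^ n ≤ c * q) (j : ℕ) :
    ((n : ℝ) + j + 1) * q ^ (n + j) ≤ 3 / 2 * c * ν ^ (j + 1) := by
  have hμ : 0 < μ := hq.trans_le hqμ
  have hn2' : (2 : ℝ) ≤ n := by exact_mod_cast hn2
  have hqn : 0 < q ^ n := by positivity
  have hc0 : 0 < c := pos_of_mul_pos_left (lt_of_lt_of_le (by positivity) hc) hq.le
  have hμν : μ ≤ ν := by
    have : 0 ≤ (1 - μ) / ((k : ℝ) + 1) := div_nonneg (by linarith) (by positivity)
    linarith
  have h1 : ((n : ℝ) + 1) * q ^ n ≤ 3 / 2 * c * ν := by nlinarith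
  have h2 : (1 + (j : ℝ) / (n + 1)) * q ^ j ≤ ν ^ j := by
    refine le_trans ?_ (one_add_div_mul_pow_le hμ hμ1 hν hn j)
    gcongr
  calc ((n : ℝ) + j + 1) * q ^ (n + j)
      = ((n + 1) * q ^ n) * ((1 + j / (n + 1)) * q ^ j) := by rw [pow_add]; field_simp; ring
    _ ≤ 3 / 2 * c * ν * ν ^ j := by
        have : 0 < ν := hμ.trans_le hμν
        gcongr
    _ = 3 / 2 * c * ν ^ (j + 1) := by ring

theorem le_mul_pow_of_step {e : ℕ → ℝ} {R q : ℝ} (hq : 0 ≤ q) (hR : 1 ≤ R)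
    (h0 : e 0 ≤ R) (hstep : ∀ j, e (j + 1) ≤ q * e j + q ^ (j + 1)) (j : ℕ) :
    e j ≤ R * (j + 1) * q ^ j := by
  induction j with
  | zero => simpa using h0
  | succ j ih =>
    have h := mul_le_mul_of_nonneg_left ih hq
    have h3 : q ^ (j + 1) ≤ R * q ^ (j + 1) := le_mul_of_one_le_left (by positivity) hR
    have h4 : q * (R * (j + 1) * q ^ j) = R * (j + 1) * q ^ (j + 1) := by ring
    push_cast
    linarith [hstep j]

end Rates

/-! ### Consequences of the warm-up condition -/

section Warmup

variable {m n : ℕ} {Y : Matrix (Fin m) (Fin n) ℝ} {r : ℕ} {Q : ℝ} {F : ℕ → ℝ} {s : ℕ → ℕ}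

theorem gap_le_one (hgap : SpectralGap Y r) (k : ℕ) : gap Y k ≤ 1 := by
  rw [← hgap.normalized]
  exact (min_le_right _ _).trans
    ((Matrix.toEuclideanLin Y).singularValues_antitone (by omega))

theorem sigma_nonneg (k : ℕ) : 0 ≤ sigma Y k := LinearMap.singularValues_nonneg _ _

theorem one_le_mismatchConst (hgap : SpectralGap Y r) {k : ℕ} (hk : 1 ≤ k) (hkr : k ≤ r) :
    1 ≤ mismatchConst Y k := by
  have h1 := hgap.pos k hk hkr
  have h2 := hgap.gap_pos k hk hkr
  have : 0 ≤ 3 * sigma Y k / gap Y k := by positivity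
  rw [mismatchConst]; linarith

theorem two_le_magnitude (hgap : SpectralGap Y r) (hQ : 2 * sigma Y 1 ≤ Q) (k : ℕ) :
    2 ≤ magnitude Y Q k := by
  have := sigma_nonneg (Y := Y) k
  rw [hgap.normalized] at hQ
  rw [magnitude]; linarith

/-- The parts of the warm-up condition that the argument uses, in terms of the head start
`s (k + 1) - s i` of the predecessor `i`. -/
theorem IsWarmup.gap_spec (hs : IsWarmup Y r Q F s)
    (hF : ∀ k, 1 ≤ k → k ≤ r → 0 < F k ∧ F k < 1) {k i : ℕ} (hkr : k < r) (hi : 1 ≤ i)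
    (hik : i ≤ k) :
    s i + 2 ≤ s (k + 1) ∧
    ((k : ℝ) + 1) * rate F k / (1 - rate F k) ≤ (s (k + 1) - s i : ℕ) ∧
    wHat (gap Y (k + 1) * (rate F i * |Real.log (rate F i)|)
          / (6 * k * magnitude Y Q i * mismatchConst Y (k + 1))) / Real.log (1 / rate F i)
      ≤ (s (k + 1) - s i : ℕ) := by
  have h := hs.step k (hi.trans hik) hkr i hi hik
  have hpos : ∀ {i : ℕ}, 1 ≤ i → i ≤ k → ∀ a, 0 ≤ wHat a / Real.log (1 / rate F i) := by
    intro i hi hik a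
    obtain ⟨h0, h1⟩ := rate_pos_lt_one hF hi (hik.trans hkr.le)
    exact div_nonneg (zero_le_one.trans (le_max_left _ _))
      (Real.log_nonneg ((one_le_div h0).mpr h1.le))
  obtain ⟨h0, h1⟩ := rate_pos_lt_one hF (hi.trans hik) hkr.le
  have hA := hpos hi hik (rate F i * |Real.log (rate F i)| / k)
  have hB := hpos hi hik (gap Y (k + 1) * (rate F i * |Real.log (rate F i)|)
          / (6 * k * magnitude Y Q i * mismatchConst Y (k + 1)))
  have hD := hpos (hi.trans hik) le_rfl (rate F k * |Real.log (rate F k)|)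
  have hC : 0 ≤ ((k : ℝ) + 1) * rate F k / (1 - rate F k) :=
    div_nonneg (by positivity) (by linarith)
  rw [warmupBound] at h
  have h2 : s i + 2 ≤ s (k + 1) := by
    have : (s i : ℝ) + 2 ≤ s (k + 1) := by linarith
    exact_mod_cast this
  rw [Nat.cast_sub (by omega)]
  exact ⟨h2, by linarith, by linarith⟩

theorem IsWarmup.le_start (hs : IsWarmup Y r Q F s)
    (hF : ∀ k, 1 ≤ k → k ≤ r → 0 < F k ∧ F k < 1) {k : ℕ} (hk : 1 ≤ k) (hkr : k ≤ r) :
    k ≤ s k := by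
  induction k, hk using Nat.le_induction with
  | base => exact hs.start.ge
  | succ k hk ih =>
    have h1 := (hs.gap_spec hF hkr hk le_rfl).1
    have h2 := ih (by omega)
    omega

theorem IsWarmup.start_mono (hs : IsWarmup Y r Q F s)
    (hF : ∀ k, 1 ≤ k → k ≤ r → 0 < F k ∧ F k < 1) {i k : ℕ} (hi : 1 ≤ i) (hik : i < k)
    (hkr : k ≤ r) : s i ≤ s k := by
  obtain ⟨k, rfl⟩ := Nat.exists_eq_add_of_le' (by omega : 1 ≤ k)
  exact le_trans (by omega) (hs.gap_spec hF hkr hi (by omega)).1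

/-- From round `s k` on, the error bounds of the predecessors add up to a mismatch that decays at the
rate of component `k` itself and is small compared with the gap. -/
theorem sum_predecessor_le (hgap : SpectralGap Y r) (hQ : 2 * sigma Y 1 ≤ Q)
    (hs : IsWarmup Y r Q F s) (hF : ∀ k, 1 ≤ k → k ≤ r → 0 < F k ∧ F k < 1) {k : ℕ}
    (hk : 1 ≤ k) (hkr : k ≤ r) (j : ℕ) :
    ∑ i ∈ Finset.Ico 1 k,
      magnitude Y Q i * ((s k + j - s i : ℕ) + 1) * rate F i ^ (s k + j - s i)
      ≤ gap Y k / (4 * mismatchConst Y k) * rate F k ^ (j + 1) := by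
  have hC := one_le_mismatchConst hgap hk hkr
  have hg := hgap.gap_pos k hk hkr
  obtain ⟨hk0, -⟩ := rate_pos_lt_one hF hk hkr
  obtain rfl | hk1 := hk.eq_or_lt
  · simp only [Finset.Ico_self, Finset.sum_empty]
    positivity
  obtain ⟨k, rfl⟩ := Nat.exists_eq_add_of_le' hk
  have hkpos : 1 ≤ k := by omega
  have hkpos' : (1 : ℝ) ≤ k := by exact_mod_cast hkpos
  set C := mismatchConst Y (k + 1)
  set g := gap Y (k + 1)
  have hterm : ∀ i ∈ Finset.Ico 1 (k + 1),
      magnitude Y Q i * ((s (k + 1) + j - s i : ℕ) + 1) * rate F i ^ (s (k + 1) + j - s i)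
        ≤ g / (4 * k * C) * rate F (k + 1) ^ (j + 1) := by
    intro i hi
    obtain ⟨hi1, hik⟩ := Finset.mem_Ico.mp hi
    have hik : i ≤ k := by omega
    obtain ⟨h2, hn, hW⟩ := hs.gap_spec hF hkr hi1 hik
    have hR := two_le_magnitude hgap hQ i
    set R := magnitude Y Q i
    obtain ⟨hi0, hi1'⟩ := rate_pos_lt_one hF hi1 (hik.trans (by omega))
    have hden : 1 ≤ 6 * k * R * C := by
      have h3 : 1 ≤ (k : ℝ) * C := one_le_mul_of_one_le_of_one_le hkpos' hC
      nlinarith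
    have hc1 : g / (6 * k * R * C) ≤ 1 := by
      rw [div_le_one (by linarith)]
      exact (gap_le_one hgap _).trans hden
    rw [mul_div_right_comm] at hW
    have hnp := natCast_mul_pow_le (by positivity) hc1 hi0 hi1' hW
    have hmain := succ_mul_pow_le hi0 (rate_mono hF hi1 hik (by omega))
      (rate_pos_lt_one hF hkpos (by omega)).2 (rate_add_le_rate_succ hkpos)
      (by omega : 2 ≤ s (k + 1) - s i) hn hnp j
    have hsub : s (k + 1) + j - s i = s (k + 1) - s i + j := by omega
    rw [hsub, mul_assoc]
    push_cast
    calc R * (((s (k + 1) - s i : ℕ) + (j : ℝ) + 1) * rate F i ^ (s (k + 1) - s i + j))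
        ≤ R * (3 / 2 * (g / (6 * k * R * C)) * rate F (k + 1) ^ (j + 1)) := by gcongr
      _ = g / (4 * k * C) * rate F (k + 1) ^ (j + 1) := by field_simp; norm_num
  refine (Finset.sum_le_sum hterm).trans (le_of_eq ?_)
  rw [Finset.sum_const, Nat.card_Ico, Nat.add_sub_cancel, nsmul_eq_mul]
  field_simp

theorem tendsto_selfCorrectionBound (hF : ∀ k, 1 ≤ k → k ≤ r → 0 < F k ∧ F k < 1) {k : ℕ}
    (hkr : k ≤ r) :
    Tendsto (fun ℓ => selfCorrectionBound Y Q F s k ℓ) atTop (𝓝 0) := by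
  have h : ∀ i ∈ Finset.Ico 1 k, Tendsto (fun ℓ : ℕ =>
      magnitude Y Q i * ((ℓ : ℝ) - (s i : ℝ) + 1) * rate F i ^ (ℓ - s i)) atTop (𝓝 0) := by
    intro i hi
    obtain ⟨hi1, hik⟩ := Finset.mem_Ico.mp hi
    obtain ⟨h0, h1⟩ := rate_pos_lt_one hF hi1 (hik.le.trans hkr)
    refine (tendsto_add_atTop_iff_nat (s i)).mp ?_
    have h2 := ((tendsto_self_mul_const_pow_of_lt_one h0.le h1).add
      (tendsto_pow_atTop_nhds_zero_of_lt_one h0.le h1)).const_mul (magnitude Y Q i)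
    rw [add_zero, mul_zero] at h2
    refine h2.congr fun ℓ => ?_
    rw [Nat.add_sub_cancel]
    push_cast
    ring
  have h2 := (tendsto_finsetSum _ h).const_mul 3
  simpa [selfCorrectionBound] using h2

end Warmup

/-! ### Parallel deflation -/

section Run

variable {m d n : ℕ} {X : Matrix (Fin d) (Fin n) ℝ} {Y : Matrix (Fin m) (Fin n) ℝ} {r : ℕ} {Q : ℝ}
  {rank1 : ℕ → ℕ → Rank1 m d n} {T : ℕ} {w wbar : ℕ → ℕ → Factors m d} {wstar : ℕ → Factors m d}
  {F : ℕ → ℝ} {s : ℕ → ℕ}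

/-- `projBall` read in the Euclidean space of entries. -/
theorem projBall_eq {A : Matrix (Fin m) (Fin n) ℝ} :
    entries (projBall Q A)
      = if ‖entries A‖ ≤ Q then entries A else (Q / ‖entries A‖) • entries A := by
  rw [projBall, apply_ite entries, map_smul, norm_entries]

theorem norm_projBall_le (hQ : 0 ≤ Q) (A : Matrix (Fin m) (Fin n) ℝ) : ‖projBall Q A‖ ≤ Q := by
  rw [← norm_entries, projBall_eq]
  split_ifs with h
  · exact h
  · have : 0 < ‖entries A‖ := hQ.trans_lt (not_le.mp h)
    rw [norm_smul, Real.norm_of_nonneg (by positivity), div_mul_cancel₀ _ this.ne']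

theorem norm_projBall_sub_le (hQ : 0 ≤ Q) (A : Matrix (Fin m) (Fin n) ℝ)
    {B : Matrix (Fin m) (Fin n) ℝ} (hB : ‖B‖ ≤ Q) : ‖projBall Q A - B‖ ≤ ‖A - B‖ := by
  rw [← norm_entries, ← norm_entries (A - B), map_sub, map_sub, projBall_eq]
  split_ifs with h
  · exact le_rfl
  · exact norm_radial_sub_le hQ (not_le.mp h) (by rwa [norm_entries])

theorem IsParallelRun.norm_component_le (hrun : IsParallelRun X Y r Q rank1 T w) (hQ : 0 ≤ Q)
    (hinit : ∀ k, 1 ≤ k → k ≤ r → ‖component X (w k 0)‖ ≤ Q) {k : ℕ} (hk : 1 ≤ k) (hkr : k ≤ r)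
    (ℓ : ℕ) : ‖component X (w k ℓ)‖ ≤ Q := by
  induction ℓ with
  | zero => exact hinit k hk hkr
  | succ ℓ ih =>
    by_cases h : ℓ + 1 < k
    · rw [hrun.idle k (ℓ + 1) hk hkr (by omega) h]; exact ih
    · rw [hrun.active k (ℓ + 1) hk hkr (by omega)]; exact norm_projBall_le hQ _

theorem norm_deflationTarget_sub_le (k ℓ : ℕ) :
    ‖deflationTarget X Y w k ℓ - cleanTarget X Y wstar k‖
      ≤ ∑ i ∈ Finset.Ico 1 k, ‖component X (w i (ℓ - 1)) - component X (wstar i)‖ := by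
  rw [deflationTarget, cleanTarget, sub_sub_sub_cancel_left, norm_sub_rev,
    ← Finset.sum_sub_distrib]
  exact norm_sum_le _ _

/-- One active round: if the best fit of the current target is within `ε ≤ 1` of the ideal
component, it lies in the projection ball, and the error contracts up to `2 ε`. -/
theorem IsParallelRun.norm_component_sub_le_step (hrun : IsParallelRun X Y r Q rank1 T w)
    (hgap : SpectralGap Y r) (hQ : 2 * sigma Y 1 ≤ Q)
    (hcontr : SubroutineContracts X Y r rank1 T w wbar F)
    {Wstar : Matrix (Fin m) (Fin d) ℝ} (hY : Y = Wstar * X)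
    (hstar : IsIdealComponents X Y r wstar) {k ℓ : ℕ} (hk : 1 ≤ k) (hkr : k ≤ r) (hℓ : k ≤ ℓ)
    {ε : ℝ} (hε : ε ≤ 1)
    (hδ : mismatchConst Y k * ‖deflationTarget X Y w k ℓ - cleanTarget X Y wstar k‖ ≤ ε) :
    ‖component X (w k ℓ) - component X (wstar k)‖
      ≤ F k * ‖component X (w k (ℓ - 1)) - component X (wstar k)‖ + 2 * ε := by
  obtain ⟨hF0, hF1, hc⟩ := hcontr k hk hkr
  obtain ⟨hbest, hc⟩ := hc ℓ hℓ
  have hbar := (norm_bestFit_sub_ideal_le hY hgap hstar hk hkr hbest).trans hδ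
  have hstarn := norm_component_ideal hY hgap hstar hk hkr
  have hσ : sigma Y k ≤ 1 := by
    rw [← hgap.normalized]
    exact (Matrix.toEuclideanLin Y).singularValues_antitone (by omega)
  rw [hgap.normalized] at hQ
  set A := component X (w k ℓ)
  set A' := component X (w k (ℓ - 1))
  set B := component X (wbar k ℓ)
  set P := component X (wstar k)
  -- `‖B‖ ≤ σ_k + ε ≤ 2 ≤ Q`.
  have hB : ‖B‖ ≤ Q := by
    have := norm_le_norm_add_norm_sub' B P
    linarith
  have h1 : ‖A - B‖ ≤ F k * ‖A' - B‖ := by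
    refine le_trans ?_ hc
    have := hrun.active k ℓ hk hkr hℓ
    simp only [A, this]
    exact norm_projBall_sub_le (by linarith) _ hB
  have h2 : ‖A - P‖ ≤ ‖A - B‖ + ‖B - P‖ := norm_sub_le_norm_sub_add_norm_sub _ _ _
  have h3 : ‖A' - B‖ ≤ ‖A' - P‖ + ‖P - B‖ := norm_sub_le_norm_sub_add_norm_sub _ _ _
  rw [norm_sub_rev P B] at h3
  have hε0 : 0 ≤ ε := (norm_nonneg _).trans hbar
  nlinarith [mul_le_mul_of_nonneg_left h3 hF0.le]

theorem IsParallelRun.norm_component_sub_ideal_le (hrun : IsParallelRun X Y r Q rank1 T w)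
    (hgap : SpectralGap Y r) (hQ : 2 * sigma Y 1 ≤ Q)
    (hinit : ∀ k, 1 ≤ k → k ≤ r → ‖component X (w k 0)‖ ≤ Q)
    (hcontr : SubroutineContracts X Y r rank1 T w wbar F)
    {Wstar : Matrix (Fin m) (Fin d) ℝ} (hY : Y = Wstar * X)
    (hstar : IsIdealComponents X Y r wstar) (hs : IsWarmup Y r Q F s) {k : ℕ} (hk : 1 ≤ k)
    (hkr : k ≤ r) (j : ℕ) :
    ‖component X (w k (s k + j - 1)) - component X (wstar k)‖
      ≤ magnitude Y Q k * (j + 1) * rate F k ^ j := by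
  have hF : ∀ k, 1 ≤ k → k ≤ r → 0 < F k ∧ F k < 1 := fun k hk hkr =>
    ⟨(hcontr k hk hkr).1, (hcontr k hk hkr).2.1⟩
  have hQ0 : 0 ≤ Q := by rw [hgap.normalized] at hQ; linarith
  induction k using Nat.strong_induction_on generalizing j with
  | _ k ih =>
  have hC := one_le_mismatchConst hgap hk hkr
  have hg := hgap.gap_pos k hk hkr
  obtain ⟨hk0, hk1⟩ := rate_pos_lt_one hF hk hkr
  have hks := hs.le_start hF hk hkr
  have hmis : ∀ j, ‖deflationTarget X Y w k (s k + j) - cleanTarget X Y wstar k‖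
      ≤ gap Y k / (4 * mismatchConst Y k) * rate F k ^ (j + 1) := by
    intro j
    refine (norm_deflationTarget_sub_le _ _).trans
      ((Finset.sum_le_sum fun i hi => ?_).trans (sum_predecessor_le hgap hQ hs hF hk hkr j))
    obtain ⟨hi1, hik⟩ := Finset.mem_Ico.mp hi
    have hsi := hs.start_mono hF hi1 hik hkr
    have h := ih i hik hi1 (by omega) (s k + j - s i)
    rwa [Nat.add_sub_cancel' (by omega)] at h
  refine le_mul_pow_of_step (e := fun j => ‖component X (w k (s k + j - 1)) -
    component X (wstar k)‖) hk0.le (by linarith [two_le_magnitude hgap hQ k]) ?_ (fun j => ?_) j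
  · refine (norm_sub_le _ _).trans (add_le_add ?_ ?_)
    · exact hrun.norm_component_le hQ0 hinit hk hkr _
    · exact (norm_component_ideal hY hgap hstar hk hkr).le
  · have hpow : 0 < rate F k ^ (j + 1) := by positivity
    have hpow1 : rate F k ^ (j + 1) ≤ 1 := pow_le_one₀ hk0.le hk1.le
    have hε : mismatchConst Y k * ‖deflationTarget X Y w k (s k + j) - cleanTarget X Y wstar k‖
        ≤ rate F k ^ (j + 1) / 2 := by
      refine (mul_le_mul_of_nonneg_left (hmis j) (by linarith)).trans ?_
      rw [show mismatchConst Y k * (gap Y k / (4 * mismatchConst Y k) * rate F k ^ (j + 1))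
        = gap Y k / 4 * rate F k ^ (j + 1) by field_simp]
      nlinarith [gap_le_one hgap k]
    have h := hrun.norm_component_sub_le_step hgap hQ hcontr hY hstar hk hkr
      (by omega : k ≤ s k + j) (by linarith) hε
    simp only [← add_assoc, Nat.add_sub_cancel]
    refine h.trans ?_
    have := mul_le_mul_of_nonneg_right (le_rate (F := F) hk)
      (norm_nonneg (component X (w k (s k + j - 1)) - component X (wstar k)))
    linarith

end Run

/-! ### Sequential deflation -/

section Sequential

variable {m d n : ℕ} {X : Matrix (Fin d) (Fin n) ℝ} {Y : Matrix (Fin m) (Fin n) ℝ} {r : ℕ}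
  {wstar : ℕ → Factors m d}

theorem IsSequentialRun.deflationTarget_eq {rank1 : ℕ → Rank1 m d n} {T : ℕ → ℕ}
    {v : ℕ → ℕ → Factors m d} (hv : IsSequentialRun X Y r rank1 T v) {k ℓ : ℕ} (hkr : k ≤ r)
    (hℓ : k ≤ ℓ) : deflationTarget X Y v k ℓ = sequentialTarget X Y k fun i => v i i := by
  have hconst : ∀ i, 1 ≤ i → i ≤ r → ∀ ℓ, i ≤ ℓ → v i ℓ = v i i := by
    intro i hi hir ℓ hℓ
    induction ℓ, hℓ using Nat.le_induction with
    | base => rfl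
    | succ ℓ hℓ ih => rw [hv.frozen i (ℓ + 1) hi hir (by omega) (by omega), Nat.add_sub_cancel, ih]
  rw [deflationTarget, sequentialTarget,
    Finset.sum_coe_sort (Finset.Ico 1 k) fun i => component X (v i i)]
  congr 1
  refine Finset.sum_congr rfl fun i hi => ?_
  obtain ⟨hi1, hik⟩ := Finset.mem_Ico.mp hi
  rw [hconst i hi1 (by omega) (ℓ - 1) (by omega)]

open scoped Pointwise in
/-- A nonzero level set of a continuous function that is homogeneous of degree two is null.
Otherwise all the dilates of it, which are contained in different level sets, have positive measure,
and there are uncountably many. -/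
theorem volume_level_eq_zero {E : Type*} [NormedAddCommGroup E] [NormedSpace ℝ E]
    [FiniteDimensional ℝ E] [MeasurableSpace E] [BorelSpace E] (μ : Measure E)
    [μ.IsAddHaarMeasure] {f : E → ℝ} (hf : Continuous f)
    (hhom : ∀ (t : ℝ) x, f (t • x) = t ^ 2 * f x) {c : ℝ} (hc : c ≠ 0) :
    μ {x | f x = c} = 0 := by
  by_contra hne
  have hlevel : ∀ t : ℝ, 0 < t → 0 < μ {x | f x = t ^ 2 * c} := by
    intro t ht
    have hsub : t • {x | f x = c} ⊆ {x | f x = t ^ 2 * c} := by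
      rintro _ ⟨x, hx, rfl⟩
      change f (t • x) = _
      rw [hhom, hx]
    refine lt_of_lt_of_le ?_ (measure_mono hsub)
    rw [Measure.addHaar_smul]
    have : 0 < |t ^ Module.finrank ℝ E| := by positivity
    exact ENNReal.mul_pos (ENNReal.ofReal_pos.mpr this).ne' hne
  have hcount := Measure.countable_meas_level_set_pos (μ := μ) hf.measurable
  have hinj : Set.InjOn (fun t : ℝ => t ^ 2 * c) (Set.Ioi 0) := by
    intro a ha b hb hab
    exact (sq_eq_sq₀ (le_of_lt ha) (le_of_lt hb)).mp (mul_right_cancel₀ hc hab)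
  have himg : ((fun t : ℝ => t ^ 2 * c) '' Set.Ioi 0).Countable :=
    hcount.mono (by rintro _ ⟨t, ht, rfl⟩; exact hlevel t ht)
  have h0 := (Set.countable_of_injective_of_countable_image hinj himg).measure_zero volume
  rw [Real.volume_Ioi] at h0
  exact ENNReal.top_ne_zero h0

theorem continuous_component_apply (X : Matrix (Fin d) (Fin n) ℝ) (i : Fin m) (j : Fin n) :
    Continuous fun p : Factors m d => component X p i j := by
  simp only [component, Matrix.mul_apply, Matrix.vecMulVec_apply]
  fun_prop

theorem isNowhereDense_volume_sequentialTarget {Z : Matrix (Fin m) (Fin n) ℝ} (hZ : Z ≠ Y)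
    (k : ℕ) :
    IsNowhereDense {p : Finset.Ico 1 k → Factors m d | ‖sequentialTarget X Y k p - Z‖ = 0} ∧
      volume {p : Finset.Ico 1 k → Factors m d | ‖sequentialTarget X Y k p - Z‖ = 0} = 0 := by
  obtain ⟨i, j, hij⟩ : ∃ i j, (Y - Z) i j ≠ 0 := by
    by_contra! h
    exact hZ (sub_eq_zero.mp (Matrix.ext h)).symm
  set f : (Finset.Ico 1 k → Factors m d) → ℝ := fun p => ∑ l, component X (p l) i j with hf
  have hcont : Continuous f := by
    refine continuous_finsetSum _ fun l _ => ?_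
    exact (continuous_component_apply X i j).comp (continuous_apply l)
  have hhom : ∀ (t : ℝ) p, f (t • p) = t ^ 2 * f p := by
    intro t p
    simp only [hf, Finset.mul_sum]
    refine Finset.sum_congr rfl fun l _ => ?_
    simp only [component, Matrix.mul_apply, Matrix.vecMulVec_apply, Finset.mul_sum]
    refine Finset.sum_congr rfl fun q _ => ?_
    simp only [Pi.smul_apply, Prod.smul_fst, Prod.smul_snd, smul_eq_mul]
    ring
  have hsub : {p : Finset.Ico 1 k → Factors m d | ‖sequentialTarget X Y k p - Z‖ = 0}
      ⊆ {p | f p = (Y - Z) i j} := by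
    intro p hp
    have h0 : sequentialTarget X Y k p = Z := sub_eq_zero.mp (norm_eq_zero.mp hp)
    have h1 := congrArg (fun A : Matrix (Fin m) (Fin n) ℝ => A i j) h0
    simp only [sequentialTarget, Matrix.sub_apply, Matrix.sum_apply] at h1
    simp only [Set.mem_ofPred_eq, hf, Matrix.sub_apply]
    linarith
  have hfac : (volume : Measure (Factors m d)).IsAddHaarMeasure :=
    Measure.prod.instIsAddHaarMeasure volume volume
  have hhaar : (volume : Measure (Finset.Ico 1 k → Factors m d)).IsAddHaarMeasure :=
    Measure.pi.isAddHaarMeasure _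
  have hvol : volume {p | f p = (Y - Z) i j} = 0 := volume_level_eq_zero volume hcont hhom hij
  refine ⟨?_, measure_mono_null hsub hvol⟩
  have hclosed : IsClosed {p | f p = (Y - Z) i j} := isClosed_eq hcont continuous_const
  refine IsNowhereDense.mono hsub (hclosed.isNowhereDense_iff.mpr ?_)
  exact Measure.interior_eq_empty_of_null hvol

end Sequential

end ParallelDeflation

theorem proposition1 {m d n : ℕ}
    (Wstar : Matrix (Fin m) (Fin d) ℝ) (X : Matrix (Fin d) (Fin n) ℝ)
    (Y : Matrix (Fin m) (Fin n) ℝ) (hY : Y = Wstar * X)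
    (r : ℕ) (hgap : SpectralGap Y r)
    (Q : ℝ) (hQ : 2 * sigma Y 1 ≤ Q)
    (wstar : ℕ → Factors m d) (hstar : IsIdealComponents X Y r wstar)
    (rank1 : ℕ → ℕ → Rank1 m d n) (T : ℕ)
    (w : ℕ → ℕ → Factors m d) (hrun : IsParallelRun X Y r Q rank1 T w)
    (hinit : ∀ k, 1 ≤ k → k ≤ r → ‖component X (w k 0)‖ ≤ Q)
    (wbar : ℕ → ℕ → Factors m d) (F : ℕ → ℝ)
    (hcontr : SubroutineContracts X Y r rank1 T w wbar F)
    (s : ℕ → ℕ) (hs : IsWarmup Y r Q F s) :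
    (∀ k, 1 ≤ k → k ≤ r →
      (∀ ℓ, s k ≤ ℓ →
        ‖deflationTarget X Y w k ℓ - cleanTarget X Y wstar k‖ ≤ selfCorrectionBound Y Q F s k ℓ) ∧
      Tendsto (fun ℓ => selfCorrectionBound Y Q F s k ℓ) atTop (𝓝 0) ∧
      Tendsto (fun ℓ => ‖deflationTarget X Y w k ℓ - cleanTarget X Y wstar k‖) atTop (𝓝 0)) ∧
    (∀ (rank1seq : ℕ → Rank1 m d n) (Tseq : ℕ → ℕ) (v : ℕ → ℕ → Factors m d),
      IsSequentialRun X Y r rank1seq Tseq v →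
      ∀ k, 1 ≤ k → k ≤ r → ∀ ℓ, k ≤ ℓ →
        ‖deflationTarget X Y v k ℓ - cleanTarget X Y wstar k‖
          = ‖sequentialTarget X Y k (fun i => v i i) - cleanTarget X Y wstar k‖) ∧
    (∀ k, 2 ≤ k → k ≤ r →
      IsNowhereDense {p : Finset.Ico 1 k → Factors m d |
        ‖sequentialTarget X Y k p - cleanTarget X Y wstar k‖ = 0} ∧
      volume {p : Finset.Ico 1 k → Factors m d |
        ‖sequentialTarget X Y k p - cleanTarget X Y wstar k‖ = 0} = 0) := by

  have hF : ∀ k, 1 ≤ k → k ≤ r → 0 < F k ∧ F k < 1 := fun k hk hkr =>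
    ⟨(hcontr k hk hkr).1, (hcontr k hk hkr).2.1⟩
  refine ⟨fun k hk hkr => ?_, fun _ _ v hv k _ hkr ℓ hℓ => by rw [hv.deflationTarget_eq hkr hℓ],
    fun k hk hkr => isNowhereDense_volume_sequentialTarget (cleanTarget_ne hY hgap hstar hk hkr) k⟩
  have hbound : ∀ ℓ, s k ≤ ℓ → ‖deflationTarget X Y w k ℓ - cleanTarget X Y wstar k‖
      ≤ selfCorrectionBound Y Q F s k ℓ := by
    intro ℓ hℓ
    refine (norm_deflationTarget_sub_le k ℓ).trans ?_
    rw [selfCorrectionBound, Finset.mul_sum]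
    refine Finset.sum_le_sum fun i hi => ?_
    obtain ⟨hi1, hik⟩ := Finset.mem_Ico.mp hi
    have hsi : s i ≤ ℓ := (hs.start_mono hF hi1 hik hkr).trans hℓ
    have h := hrun.norm_component_sub_ideal_le hgap hQ hinit hcontr hY hstar hs hi1
      (by omega) (ℓ - s i)
    rw [Nat.add_sub_cancel' hsi, Nat.cast_sub hsi] at h
    linarith [norm_nonneg (component X (w i (ℓ - 1)) - component X (wstar i))]
  have hlim := tendsto_selfCorrectionBound (Y := Y) (Q := Q) (s := s) hF hkr
  exact ⟨hbound, hlim, squeeze_zero' (Eventually.of_forall fun _ => norm_nonneg _)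
    ((eventually_ge_atTop (s k)).mono hbound) hlim⟩
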